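/- Let $f:\mathbb{R}\to[0,\infty)$ be a nondecreasing right-continuous function vanishing on $(-\infty,0)$. Let $a>0$, put $\varepsilon(t):=f(t)-at$ for $t\ge 0$ and $\varepsilon(t):=0$ for $t<0$, and assume that $$\int_{[0,\infty)} y\,|{\rm d}\varepsilon(y)|<\infty,$$ where $|{\rm d}\varepsilon|$ is the Lebesgue–Stieltjes measure generated by the function $t\mapsto \mathcal V_{[0,t]}(\varepsilon)$, the total variation of $\varepsilon$ on $[0,t]$. Then $\varepsilon$ has finite total variation, the limit $\lim_{t\to\infty}(f(t)-at)$ exists and is finite, and $$\gamma_0:=\int_{[0,\infty)}{\rm d}\varepsilon(y)=\lim_{t\to\infty}(f(t)-at)$$ (the integral includes the possible jump $f(0)$ of $\varepsilon$ at $0$). Moreover, for every function $j=j(t)$ with values in the nonnegative integers such that $j(t)=o(t^{2/3})$ as $t\to\infty$, $$f^{\ast(j)}(t)\sim \frac{a^j t^j}{j!}\exp\left(\frac{\gamma_0 j^2}{at}\right),\qquad t\to\infty,$$ that is, the ratio of the two sides (taken at $j=j(t)$) tends to $1$. Here $f^{\ast(j)}$ is the $j$-fold Lebesgue–Stieltjes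 convolution power: $f^{\ast(0)}=\mathbf 1_{[0,\infty)}$ and $f^{\ast(j+1)}(t)=\int_{[0,t]} f^{\ast(j)}(t-y)\,{\rm d}f(y)$ for $t\ge 0$, $f^{\ast(j+1)}(t)=0$ for $t<0$. -/

import Mathlib

open Set Filter MeasureTheory Topology Asymptotics

/-- Lebesgue--Stieltjes convolution `(u * v)(t) = ∫_ℝ u(t - y) dv(y)`, for `v` nondecreasing and
right-continuous. If `u` and `v` vanish on `(-∞, 0)`, the integral is over `[0, t]`. -/
noncomputable def lsConv (u : ℝ → ℝ) (v : StieltjesFunction ℝ) (t : ℝ) : ℝ :=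
  ∫ y, u (t - y) ∂v.measure

/-- Convolution powers `f^{*(j)}`, with the convention that `f^{*(0)}` is the indicator function
of `[0, ∞)`. -/
noncomputable def convPow (f : StieltjesFunction ℝ) : ℕ → ℝ → ℝ
  | 0 => (Ici (0 : ℝ)).indicator 1
  | j + 1 => lsConv (convPow f j) f

/-- The function `ε` on the real line: `ε(t) = f(t) - a t` for `t ≥ 0`. On the negative half-line
it equals `f`, so it vanishes there as soon as `f` does. -/
noncomputable def excess (f : StieltjesFunction ℝ) (a : ℝ) (t : ℝ) : ℝ :=
  f t - a * max t 0

theorem excess_locallyBoundedVariationOn (f : StieltjesFunction ℝ) (a : ℝ) :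
    LocallyBoundedVariationOn (excess f a) univ := by
  have hm : Monotone (fun t : ℝ => max t 0) := fun x y h => max_le_max_right 0 h
  have hg : Monotone (fun t : ℝ => f t + |a| * max t 0) :=
    f.mono.add (hm.const_mul (abs_nonneg a))
  have key : ∀ x y : ℝ, edist (excess f a x) (excess f a y) ≤
      edist (f x + |a| * max x 0) (f y + |a| * max y 0) := by
    have hle : ∀ x y : ℝ, x ≤ y → edist (excess f a x) (excess f a y) ≤
        edist (f x + |a| * max x 0) (f y + |a| * max y 0) := by
      intro x y hxy
      have h1 := f.mono hxy
      have h2 := hm hxy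
      simp only at h2
      have h3 := mul_le_mul_of_nonneg_right (le_abs_self a) (sub_nonneg.2 h2)
      have h4 := mul_le_mul_of_nonneg_right (neg_abs_le a) (sub_nonneg.2 h2)
      have h5 := mul_nonneg (abs_nonneg a) (sub_nonneg.2 h2)
      rw [edist_dist, edist_dist, Real.dist_eq, Real.dist_eq]
      refine ENNReal.ofReal_le_ofReal ?_
      rw [abs_le, abs_sub_comm (f x + |a| * max x 0), abs_of_nonneg (by linarith)]
      unfold excess
      constructor <;> linarith
    intro x y
    rcases le_total x y with h | h
    · exact hle x y h
    · rw [edist_comm, edist_comm (f x + _)]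
      exact hle y x h
  intro x y hx hy
  refine ne_top_of_le_ne_top ((hg.monotoneOn univ).locallyBoundedVariationOn x y hx hy) ?_
  exact iSup_mono fun p => Finset.sum_le_sum fun i _ => key _ _

theorem excess_continuousWithinAt (f : StieltjesFunction ℝ) (a x : ℝ) :
    ContinuousWithinAt (excess f a) (Ici x) x :=
  (f.right_continuous x).sub (by fun_prop)

/-- The total variation function of `ε`, normalised to vanish at `0`: its value at `t ≥ 0` is the
total variation of `ε` on `[0, t]`. The Lebesgue--Stieltjes measure of this function
is `|dε|`. -/
noncomputable def excessVariation (f : StieltjesFunction ℝ) (a : ℝ) : StieltjesFunction ℝ where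
  toFun := variationOnFromTo (excess f a) univ 0
  mono' := monotoneOn_univ.1
    (variationOnFromTo.monotoneOn (excess_locallyBoundedVariationOn f a) (mem_univ _))
  right_continuous' := fun x => by
    have hx : Tendsto (excess f a) (𝓝[univ ∩ Ioi x] x) (𝓝 (excess f a x)) :=
      (excess_continuousWithinAt f a x).mono (by simp)
    have h := variationOnFromTo.tendsto_right (mem_univ 0) (mem_univ x)
      (excess_locallyBoundedVariationOn f a) hx
    simp only [univ_inter, dist_self, add_zero] at h
    exact continuousWithinAt_Ioi_iff_Ici.1 h

/-! Write `F` for convolution with `df` and `L` for convolution with the density `a` on `[-s, ∞)`,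
where `s = γ₀ / a`. The powers of `L` are explicit: `L ^ j` sends the step function to `a ^ j * (t +
j * s) ^ j / j!`, and since `j ^ 3 / t ^ 2 → 0` this is asymptotic to the claimed expression. It
remains to replace `F` by `L`.

The difference `R = F - L` is convolution with a finite signed measure which has a finite first
moment and, by the choice of `s`, total mass zero. Hence `R` is bounded in sup norm, and on a
Lipschitz function it gains from the cancellation: `R * L` is bounded too, although `L` alone is not
(`abs_diffOp_shiftOp_le`).

All these operators commute, so `F ^ j` expands binomially into terms `R ^ k * L ^ (j - k)`. If `2 *
k ≤ j`, each `R` is paired with one `L`; only `L ^ (j - 2 * k)` remains, and relative to the main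
term the contribution is at most `(B * j ^ 3 / τ ^ 2) ^ k / k!` with `τ = t + j * s`. If `2 * k >
j`, every `L` is paired and the term is at most `D ^ j`; these terms together are negligible because
`j / τ → 0`. The result is `abs_convOp_pow_stepFn_sub_le`.

The splitting `df = a dy + P - Q` uses `Q = |dε|` and `P = |dε| + dε`, both positive with finite
mass and first moment (`exists_measure_decomposition`). -/

/-! ### Convolution operators on functions bounded on left half-lines. -/

/-- The space of measurable functions on `ℝ` that vanish near `-∞` and are bounded on every
half-line `(-∞, T]`. -/
def lowerBounded : Submodule ℝ (ℝ → ℝ) where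
  carrier := {u | Measurable u ∧ (∃ b, ∀ x < b, u x = 0) ∧ ∀ T, ∃ M, ∀ x ≤ T, |u x| ≤ M}
  zero_mem' := ⟨measurable_const, ⟨0, by simp⟩, fun T => ⟨0, by simp⟩⟩
  add_mem' := by
    rintro u v ⟨hu, ⟨b, hb⟩, hM⟩ ⟨hv, ⟨b', hb'⟩, hM'⟩
    refine ⟨hu.add hv, ⟨min b b', fun x hx => ?_⟩, fun T => ?_⟩
    · simp [hb x (hx.trans_le (min_le_left _ _)), hb' x (hx.trans_le (min_le_right _ _))]
    · obtain ⟨M, hM⟩ := hM T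
      obtain ⟨M', hM'⟩ := hM' T
      exact ⟨M + M', fun x hx => (abs_add_le _ _).trans (add_le_add (hM x hx) (hM' x hx))⟩
  smul_mem' := by
    rintro r u ⟨hu, ⟨b, hb⟩, hM⟩
    refine ⟨hu.const_smul r, ⟨b, fun x hx => by simp [hb x hx]⟩, fun T => ?_⟩
    obtain ⟨M, hM⟩ := hM T
    refine ⟨|r| * M, fun x hx => ?_⟩
    simp only [Pi.smul_apply, smul_eq_mul, abs_mul]
    exact mul_le_mul_of_nonneg_left (hM x hx) (abs_nonneg r)

/-- Measures on `ℝ` that vanish near `-∞` and are finite on every half-line `(-∞, T]`. -/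
def IsLowerFinite (μ : Measure ℝ) : Prop :=
  (∃ b, μ (Iio b) = 0) ∧ ∀ T, μ (Iic T) < ⊤

theorem IsLowerFinite.of_isFiniteMeasure {μ : Measure ℝ} [IsFiniteMeasure μ]
    (h : μ (Iio 0) = 0) : IsLowerFinite μ :=
  ⟨⟨0, h⟩, fun _ => measure_lt_top _ _⟩

theorem ae_le_of_measure_Iio {μ : Measure ℝ} {b : ℝ} (h : μ (Iio b) = 0) : ∀ᵐ y ∂μ, b ≤ y := by
  rw [ae_iff]
  simpa [Iio] using h

theorem IsLowerFinite.integrable_comp_sub {μ : Measure ℝ} (h : IsLowerFinite μ) {u : ℝ → ℝ}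
    (hu : u ∈ lowerBounded) (t : ℝ) : Integrable (fun y => u (t - y)) μ := by
  obtain ⟨hm, ⟨b, hb⟩, hM⟩ := hu
  obtain ⟨⟨β, hβ⟩, hfin⟩ := h
  obtain ⟨M, hM⟩ := hM (t - β)
  have hM0 : 0 ≤ M := (abs_nonneg _).trans (hM (t - β) le_rfl)
  have hi : Integrable ((Iic (t - b)).indicator fun _ => M) μ :=
    (integrable_indicator_iff measurableSet_Iic).2 (integrableOn_const (hfin _).ne)
  refine hi.mono' (hm.comp (measurable_const.sub measurable_id)).aestronglyMeasurable ?_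
  filter_upwards [ae_le_of_measure_Iio hβ] with y hy
  by_cases hyb : y ≤ t - b
  · rw [indicator_of_mem (mem_Iic.2 hyb)]
    exact hM _ (by linarith)
  · rw [indicator_of_notMem (by simpa using hyb), hb _ (by linarith [not_le.1 hyb])]
    simp

/-- Lower bounds on both supports and on that of `u` confine the integrand to a rectangle of finite
measure, where it is bounded. This is what Fubini needs. -/
theorem IsLowerFinite.integrable_comp_sub_sub {μ ν : Measure ℝ} [SFinite μ] [SFinite ν]
    (hμ : IsLowerFinite μ)
    (hν : IsLowerFinite ν) {u : ℝ → ℝ} (hu : u ∈ lowerBounded) (t : ℝ) :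
    Integrable (fun p : ℝ × ℝ => u (t - p.1 - p.2)) (μ.prod ν) := by
  obtain ⟨hm, ⟨b, hb⟩, hM⟩ := hu
  obtain ⟨⟨β, hβ⟩, hfin⟩ := hμ
  obtain ⟨⟨β', hβ'⟩, hfin'⟩ := hν
  obtain ⟨M, hM⟩ := hM (t - β - β')
  have hM0 : 0 ≤ M := (abs_nonneg _).trans (hM (t - β - β') le_rfl)
  have hi : Integrable ((Iic (t - b - β') ×ˢ Iic (t - b - β)).indicator fun _ => M)
      (μ.prod ν) := by
    refine (integrable_indicator_iff (measurableSet_Iic.prod measurableSet_Iic)).2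
      (integrableOn_const ?_)
    rw [Measure.prod_prod]
    exact (ENNReal.mul_lt_top (hfin _) (hfin' _)).ne
  refine hi.mono' (hm.comp (by fun_prop)).aestronglyMeasurable ?_
  filter_upwards [Measure.quasiMeasurePreserving_fst.ae (ae_le_of_measure_Iio hβ),
    Measure.quasiMeasurePreserving_snd.ae (ae_le_of_measure_Iio hβ')] with p hp hp'
  by_cases hyb : b ≤ t - p.1 - p.2
  · rw [indicator_of_mem (mem_prod.2 ⟨mem_Iic.2 (by linarith), mem_Iic.2 (by linarith)⟩)]
    exact hM _ (by linarith)
  · rw [hb _ (not_le.1 hyb)]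
    simpa using indicator_nonneg (fun _ _ => hM0) p

theorem IsLowerFinite.conv_mem {μ : Measure ℝ} [SFinite μ] (h : IsLowerFinite μ) {u : ℝ → ℝ}
    (hu : u ∈ lowerBounded) : (fun t => ∫ y, u (t - y) ∂μ) ∈ lowerBounded := by
  have hint := h.integrable_comp_sub hu
  obtain ⟨hm, ⟨b, hb⟩, hM⟩ := hu
  obtain ⟨⟨β, hβ⟩, hfin⟩ := h
  refine ⟨?_, ⟨b + β, fun t ht => ?_⟩, fun T => ?_⟩
  · have : StronglyMeasurable (fun p : ℝ × ℝ => u (p.1 - p.2)) :=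
      (hm.comp (by fun_prop)).stronglyMeasurable
    exact this.integral_prod_right.measurable
  · refine integral_eq_zero_of_ae (μ := μ) (f := fun y => u (t - y)) ?_
    filter_upwards [ae_le_of_measure_Iio hβ] with y hy
    exact hb _ (by linarith)
  · obtain ⟨M, hM⟩ := hM (T - β)
    have hM0 : 0 ≤ M := (abs_nonneg _).trans (hM (T - β) le_rfl)
    refine ⟨∫ y, (Iic (T - b)).indicator (fun _ => M) y ∂μ, fun t ht => ?_⟩
    refine norm_integral_le_of_norm_le (f := fun y => u (t - y)) (μ := μ)
      ((integrable_indicator_iff measurableSet_Iic).2 (integrableOn_const (hfin _).ne)) ?_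
    filter_upwards [ae_le_of_measure_Iio hβ] with y hy
    by_cases hyb : y ≤ T - b
    · rw [indicator_of_mem (mem_Iic.2 hyb)]
      exact hM _ (by linarith)
    · rw [indicator_of_notMem (by simpa using hyb), hb _ (by linarith [not_le.1 hyb])]
      simp

/-- Convolution with a measure, as an operator on `lowerBounded`. -/
noncomputable def convOp (μ : Measure ℝ) [SFinite μ] (h : IsLowerFinite μ) :
    Module.End ℝ lowerBounded where
  toFun u := ⟨fun t => ∫ y, u.1 (t - y) ∂μ, h.conv_mem u.2⟩
  map_add' u v := by
    ext t
    exact integral_add (h.integrable_comp_sub u.2 t) (h.integrable_comp_sub v.2 t)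
  map_smul' r u := by
    ext t
    exact integral_const_mul r _

theorem convOp_apply (μ : Measure ℝ) [SFinite μ] (h : IsLowerFinite μ) (u : lowerBounded)
    (t : ℝ) : (convOp μ h u).1 t = ∫ y, u.1 (t - y) ∂μ := rfl

theorem commute_convOp (μ ν : Measure ℝ) [SFinite μ] [SFinite ν] (hμ : IsLowerFinite μ)
    (hν : IsLowerFinite ν) : Commute (convOp μ hμ) (convOp ν hν) := by
  refine LinearMap.ext fun u => Subtype.ext (funext fun t => ?_)
  change ∫ y, ∫ z, u.1 (t - y - z) ∂ν ∂μ = ∫ z, ∫ y, u.1 (t - z - y) ∂μ ∂ν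
  rw [integral_integral_swap (hμ.integrable_comp_sub_sub hν u.2 t)]
  simp_rw [sub_right_comm t]

/-- The indicator function of `[0, ∞)` as an element of `lowerBounded`. -/
noncomputable def stepFn : lowerBounded :=
  ⟨(Ici (0 : ℝ)).indicator 1, measurable_one.indicator measurableSet_Ici,
    ⟨0, fun x hx => indicator_of_notMem (by simpa using hx) _⟩,
    fun _ => ⟨1, fun x _ => by by_cases h : x ∈ Ici (0 : ℝ) <;> simp [h]⟩⟩

theorem abs_stepFn_le (x : ℝ) : |stepFn.1 x| ≤ 1 := by
  by_cases h : x ∈ Ici (0 : ℝ) <;> simp [stepFn, h]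

theorem convPow_eq_convOp_pow (f : StieltjesFunction ℝ) (h : IsLowerFinite f.measure) (j : ℕ) :
    convPow f j = ((convOp f.measure h ^ j) stepFn).1 := by
  induction j with
  | zero => rfl
  | succ j ih =>
    ext t
    rw [pow_succ', Module.End.mul_apply, convOp_apply, ← ih]
    rfl

/-! ### Powers of convolution with a shifted Lebesgue density. -/

theorem isLowerFinite_smul_volume (a b : ℝ) :
    IsLowerFinite (ENNReal.ofReal a • volume.restrict (Ici b)) := by
  refine ⟨⟨b, ?_⟩, fun T => ?_⟩
  · have : Iio b ∩ Ici b = ∅ := by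
      ext x
      simp
    simp [Measure.restrict_apply measurableSet_Iio, this]
  · simp only [Measure.smul_apply, Measure.restrict_apply measurableSet_Iic, smul_eq_mul]
    refine ENNReal.mul_lt_top ENNReal.ofReal_lt_top ?_
    rw [inter_comm, Ici_inter_Iic]
    simp

theorem integral_smul_volume_Ici {a : ℝ} (ha : 0 ≤ a) (b t : ℝ) (u : ℝ → ℝ) :
    ∫ y, u (t - y) ∂(ENNReal.ofReal a • volume.restrict (Ici b)) =
      a * ∫ x in Iic (t - b), u x := by
  rw [integral_smul_measure, ENNReal.toReal_ofReal ha, smul_eq_mul]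
  congr 1
  rw [← integral_indicator measurableSet_Ici, ← integral_indicator measurableSet_Iic,
    ← integral_sub_left_eq_self _ volume t]
  congr 1
  ext y
  simp [indicator_apply, le_sub_comm]

theorem integrableOn_Iic {u : ℝ → ℝ} (hu : u ∈ lowerBounded) (T : ℝ) :
    IntegrableOn u (Iic T) := by
  obtain ⟨hm, ⟨b, hb⟩, hM⟩ := hu
  obtain ⟨M, hM⟩ := hM T
  have hi : IntegrableOn u (Icc b T) := by
    refine Measure.integrableOn_of_bounded (M := M) (by simp) hm.aestronglyMeasurable ?_
    filter_upwards [ae_restrict_mem measurableSet_Icc] with x hx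
    exact hM x hx.2
  refine hi.of_forall_sdiff_eq_zero measurableSet_Iic fun x hx => hb x ?_
  by_contra h
  exact hx.2 ⟨not_lt.1 h, hx.1⟩

/-- Convolution with the measure of density `a` on `[-s, ∞)`. -/
noncomputable def shiftOp (a s : ℝ) : Module.End ℝ lowerBounded :=
  convOp (ENNReal.ofReal a • volume.restrict (Ici (-s))) (isLowerFinite_smul_volume a (-s))

theorem shiftOp_apply {a : ℝ} (ha : 0 ≤ a) (s : ℝ) (u : lowerBounded) (t : ℝ) :
    (shiftOp a s u).1 t = a * ∫ x in Iic (t + s), u.1 x := by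
  rw [shiftOp, convOp_apply, integral_smul_volume_Ici ha, sub_neg_eq_add]

/-- Each application integrates the previous power up to `t + s`, so the left end of the support
moves by `-s` and the degree rises by one. -/
theorem shiftOp_pow_stepFn {a : ℝ} (ha : 0 ≤ a) (s : ℝ) (n : ℕ) (t : ℝ) :
    ((shiftOp a s ^ n) stepFn).1 t =
      if 0 ≤ t + n * s then a ^ n * (t + n * s) ^ n / n.factorial else 0 := by
  induction n generalizing t with
  | zero => simp [stepFn, indicator_apply]
  | succ n ih =>
    rw [pow_succ', Module.End.mul_apply, shiftOp_apply ha]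
    have h1 : ∫ x in Iic (t + s), ((shiftOp a s ^ n) stepFn).1 x =
        ∫ x in Icc (-(n * s)) (t + s), a ^ n * (x + n * s) ^ n / n.factorial := by
      rw [← Ici_inter_Iic, inter_comm, ← setIntegral_indicator measurableSet_Ici]
      refine integral_congr_ae (ae_of_all _ fun x => ?_)
      simp [ih, indicator_apply, neg_le_iff_add_nonneg]
    rw [h1]
    push_cast
    split_ifs with h
    · have hle : -(n * s) ≤ t + s := by linarith
      rw [integral_Icc_eq_integral_Ioc, ← intervalIntegral.integral_of_le hle,
        intervalIntegral.integral_comp_add_right (fun x => a ^ n * x ^ n / n.factorial)]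
      simp_rw [mul_div_right_comm]
      rw [intervalIntegral.integral_const_mul, integral_pow, Nat.factorial_succ]
      have : (n.factorial : ℝ) ≠ 0 := by positivity
      push_cast
      field_simp
      ring
    · rw [Icc_eq_empty (by intro h'; apply h; linarith)]
      simp

/-! ### Sup-norm bounds for the difference operator. -/

theorem abs_integral_comp_sub_le {P : Measure ℝ} [IsFiniteMeasure P] (hP : P (Iio 0) = 0)
    {u : ℝ → ℝ} {t M : ℝ} (hu : ∀ x ≤ t, |u x| ≤ M) :
    |∫ y, u (t - y) ∂P| ≤ M * P.real univ := by
  refine norm_integral_le_of_norm_le_const (μ := P) (f := fun y => u (t - y)) ?_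
  filter_upwards [ae_le_of_measure_Iio hP] with y hy
  exact hu _ (by linarith)

theorem abs_integral_sub_le {P : Measure ℝ} (hP : P (Iio 0) = 0)
    (hP1 : Integrable (fun y => y) P) {u : ℝ → ℝ} {t C : ℝ}
    (hu : ∀ x ≤ t, |u x - u t| ≤ C * |x - t|) :
    |∫ y, (u (t - y) - u t) ∂P| ≤ C * ∫ y, y ∂P := by
  rw [← integral_const_mul]
  refine norm_integral_le_of_norm_le (f := fun y => u (t - y) - u t) (hP1.const_mul C) ?_
  filter_upwards [ae_le_of_measure_Iio hP] with y hy
  refine (hu (t - y) (by linarith)).trans_eq ?_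
  rw [show t - y - t = -y by ring, abs_neg, abs_of_nonneg hy]

theorem abs_intervalIntegral_le {u : ℝ → ℝ} {t s M : ℝ} (hu : ∀ x ≤ t + |s|, |u x| ≤ M) :
    |∫ x in t..(t + s), u x| ≤ M * |s| := by
  have := intervalIntegral.norm_integral_le_of_norm_le_const (a := t) (b := t + s) (f := u)
    (C := M) fun x hx => hu x ?_
  · simpa using this
  · refine hx.2.trans (max_le ?_ ?_)
    · linarith [abs_nonneg s]
    · linarith [le_abs_self s]

/-- The measure `μ` equals the measure of density `a` on `[0, ∞)`, up to finite measures with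
finite first moment and difference of masses `a * s`. -/
structure IsLebesguePerturbation (μ P Q : Measure ℝ) (a s : ℝ) : Prop where
  pos : 0 < a
  fst_Iio : P (Iio 0) = 0
  snd_Iio : Q (Iio 0) = 0
  fst_integrable : Integrable (fun y => y) P
  snd_integrable : Integrable (fun y => y) Q
  add_eq : μ + Q = ENNReal.ofReal a • volume.restrict (Ici 0) + P
  mass_sub : P.real univ - Q.real univ = a * s

/-- The difference of the convolution with `μ` and that with density `a` on `[-s, ∞)`. -/
noncomputable def diffOp (μ : Measure ℝ) [SFinite μ] (h : IsLowerFinite μ) (a s : ℝ) :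
    Module.End ℝ lowerBounded :=
  convOp μ h - shiftOp a s

/-- The norm of `diffOp` on bounded functions is at most this constant. -/
noncomputable def boundConst (P Q : Measure ℝ) (a s : ℝ) : ℝ :=
  P.real univ + Q.real univ + a * |s|

/-- The norm of `diffOp * shiftOp` on bounded functions is at most this constant. -/
noncomputable def smoothConst (P Q : Measure ℝ) (a s : ℝ) : ℝ :=
  a * ((∫ y, y ∂P) + (∫ y, y ∂Q) + a * |s| * |s|)

theorem commute_diffOp_shiftOp {μ : Measure ℝ} [SFinite μ] (h : IsLowerFinite μ) (a s : ℝ) :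
    Commute (diffOp μ h a s) (shiftOp a s) :=
  Commute.sub_left (R := Module.End ℝ lowerBounded) (commute_convOp _ _ _ _) (Commute.refl _)

theorem convOp_pow_eq_sum {μ : Measure ℝ} [SFinite μ] (h : IsLowerFinite μ) (a s : ℝ) (j : ℕ) :
    convOp μ h ^ j = ∑ k ∈ Finset.range (j + 1),
      diffOp μ h a s ^ k * shiftOp a s ^ (j - k) * (j.choose k : Module.End ℝ lowerBounded) := by
  rw [← (commute_diffOp_shiftOp h a s).add_pow, diffOp]
  exact congrArg (· ^ j) (sub_add_cancel (G := Module.End ℝ lowerBounded) _ _).symm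

theorem convOp_pow_stepFn_sub {μ : Measure ℝ} [SFinite μ] (h : IsLowerFinite μ) (a s : ℝ) (j : ℕ) (t : ℝ) :
    ((convOp μ h ^ j) stepFn).1 t - ((shiftOp a s ^ j) stepFn).1 t =
      ∑ k ∈ Finset.Icc 1 j, (j.choose k : ℝ) *
        ((diffOp μ h a s ^ k * shiftOp a s ^ (j - k)) stepFn).1 t := by
  rw [convOp_pow_eq_sum h a s]
  have : ∀ A : Module.End ℝ lowerBounded, ∀ n : ℕ,
      ((A * (n : Module.End ℝ lowerBounded)) stepFn).1 t = n * (A stepFn).1 t := by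
    intro A n
    rw [(Nat.cast_commute n A).eq.symm, ← nsmul_eq_mul]
    simp
  rw [LinearMap.sum_apply]
  simp only [AddSubmonoidClass.coe_finsetSum, Finset.sum_apply, this]
  rw [Finset.range_eq_Ico, Finset.sum_eq_sum_Ico_succ_bot (Nat.succ_pos j)]
  simp
  rfl

namespace IsLebesguePerturbation

variable {μ P Q : Measure ℝ} {a s : ℝ}

theorem boundConst_nonneg (H : IsLebesguePerturbation μ P Q a s) : 0 ≤ boundConst P Q a s := by
  have := H.pos
  unfold boundConst
  positivity

theorem smoothConst_nonneg (H : IsLebesguePerturbation μ P Q a s) :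
    0 ≤ smoothConst P Q a s := by
  have := H.pos
  have h1 : 0 ≤ ∫ y, y ∂P := integral_nonneg_of_ae (ae_le_of_measure_Iio H.fst_Iio)
  have h2 : 0 ≤ ∫ y, y ∂Q := integral_nonneg_of_ae (ae_le_of_measure_Iio H.snd_Iio)
  unfold smoothConst
  positivity

/-- Integration turns a bound into a Lipschitz bound; this regularity is what `diffOp` exploits. -/
theorem abs_shiftOp_sub_le (H : IsLebesguePerturbation μ P Q a s) {v : lowerBounded} {T M : ℝ}
    (hv : ∀ x ≤ T + s, |v.1 x| ≤ M) {x y : ℝ} (hx : x ≤ T) (hy : y ≤ T) :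
    |(shiftOp a s v).1 x - (shiftOp a s v).1 y| ≤ a * M * |x - y| := by
  rw [shiftOp_apply H.pos.le, shiftOp_apply H.pos.le, ← mul_sub,
    intervalIntegral.integral_Iic_sub_Iic (integrableOn_Iic v.2 _) (integrableOn_Iic v.2 _),
    abs_mul, abs_of_pos H.pos, mul_assoc]
  refine mul_le_mul_of_nonneg_left ?_ H.pos.le
  have := intervalIntegral.norm_integral_le_of_norm_le_const (a := y + s) (b := x + s) (f := v.1)
    (C := M) fun z hz => hv z (hz.2.trans (max_le (by linarith) (by linarith)))
  simpa using this

variable [IsFiniteMeasure P]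

theorem isLowerFinite (H : IsLebesguePerturbation μ P Q a s) : IsLowerFinite μ := by
  have hle : μ ≤ ENNReal.ofReal a • volume.restrict (Ici 0) + P := by
    rw [← H.add_eq]
    exact Measure.le_add_right le_rfl
  refine ⟨⟨0, le_antisymm ((hle _).trans ?_) zero_le⟩, fun T => (hle _).trans_lt ?_⟩
  · have : Iio (0 : ℝ) ∩ Ici 0 = ∅ := by
      ext x
      simp
    simp [H.fst_Iio, Measure.restrict_apply measurableSet_Iio, this]
  · rw [Measure.add_apply]
    exact ENNReal.add_lt_top.2 ⟨(isLowerFinite_smul_volume a 0).2 T, measure_lt_top _ _⟩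

variable [IsFiniteMeasure Q] [SFinite μ]

theorem diffOp_apply (H : IsLebesguePerturbation μ P Q a s) (u : lowerBounded) (t : ℝ) :
    (diffOp μ H.isLowerFinite a s u).1 t =
      ∫ y, u.1 (t - y) ∂P - ∫ y, u.1 (t - y) ∂Q - a * ∫ x in t..(t + s), u.1 x := by
  have hP := (IsLowerFinite.of_isFiniteMeasure H.fst_Iio).integrable_comp_sub u.2 t
  have hQ := (IsLowerFinite.of_isFiniteMeasure H.snd_Iio).integrable_comp_sub u.2 t
  have hμ := H.isLowerFinite.integrable_comp_sub u.2 t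
  have ha := (isLowerFinite_smul_volume a 0).integrable_comp_sub u.2 t
  have h1 : ∫ y, u.1 (t - y) ∂μ + ∫ y, u.1 (t - y) ∂Q =
      a * (∫ x in Iic t, u.1 x) + ∫ y, u.1 (t - y) ∂P := by
    rw [← integral_add_measure hμ hQ, H.add_eq, integral_add_measure ha hP,
      integral_smul_volume_Ici H.pos.le, sub_zero]
  have h2 : (diffOp μ H.isLowerFinite a s u).1 t =
    ∫ y, u.1 (t - y) ∂μ - (shiftOp a s u).1 t := rfl
  rw [h2, shiftOp_apply H.pos.le, intervalIntegral.integral_Iic_sub_Iic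
    (integrableOn_Iic u.2 _) (integrableOn_Iic u.2 _) |>.symm]
  linarith

/-- For `s > 0` the operator looks to the right of `t` by `s`, so bounds are needed beyond `T`. A
margin `|s|` would do here; `2 * |s|` matches `abs_diffOp_shiftOp_le`, where `shiftOp` looks ahead
as well. -/
theorem abs_diffOp_le (H : IsLebesguePerturbation μ P Q a s) {u : lowerBounded} {T M : ℝ}
    (hu : ∀ x ≤ T + 2 * |s|, |u.1 x| ≤ M) :
    ∀ t ≤ T, |(diffOp μ H.isLowerFinite a s u).1 t| ≤ boundConst P Q a s * M := by
  intro t ht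
  have hs := abs_nonneg s
  rw [H.diffOp_apply, boundConst]
  have h1 := abs_integral_comp_sub_le H.fst_Iio (u := u.1) (t := t) (M := M)
    fun x hx => hu x (by linarith)
  have h2 := abs_integral_comp_sub_le H.snd_Iio (u := u.1) (t := t) (M := M)
    fun x hx => hu x (by linarith)
  have h3 := abs_intervalIntegral_le (u := u.1) (t := t) (s := s) (M := M)
    fun x hx => hu x (by linarith)
  have h4 : |a * ∫ x in t..(t + s), u.1 x| ≤ a * (M * |s|) := by
    rw [abs_mul, abs_of_pos H.pos]
    exact mul_le_mul_of_nonneg_left h3 H.pos.le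
  refine (abs_sub _ _).trans ?_
  have := abs_sub (∫ y, u.1 (t - y) ∂P) (∫ y, u.1 (t - y) ∂Q)
  linarith

theorem abs_diffOp_shiftOp_le (H : IsLebesguePerturbation μ P Q a s) {v : lowerBounded}
    {T M : ℝ} (hv : ∀ x ≤ T + 2 * |s|, |v.1 x| ≤ M) :
    ∀ t ≤ T, |(diffOp μ H.isLowerFinite a s (shiftOp a s v)).1 t| ≤
      smoothConst P Q a s * M := by
  intro t ht
  have hs := abs_nonneg s
  have hs' := le_abs_self s
  have ha := H.pos
  have hM : 0 ≤ M := (abs_nonneg _).trans (hv _ le_rfl)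
  set U := shiftOp a s v with hU
  have hL : ∀ x ≤ t + |s|, |U.1 x - U.1 t| ≤ a * M * |x - t| := fun x hx =>
    H.abs_shiftOp_sub_le (T := t + |s|) (fun z hz => hv z (by linarith)) hx (by linarith)
  have hP := (IsLowerFinite.of_isFiniteMeasure H.fst_Iio).integrable_comp_sub U.2 t
  have hQ := (IsLowerFinite.of_isFiniteMeasure H.snd_Iio).integrable_comp_sub U.2 t
  have hUi : IntervalIntegrable U.1 volume t (t + s) :=
    ((integrableOn_Iic U.2 (max t (t + s))).mono_set fun x hx => hx.2).intervalIntegrable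
  -- Total mass zero (`mass_sub`) allows the constant `U t` to be subtracted in all three integrals
  -- at no cost.
  have hsplit : (diffOp μ H.isLowerFinite a s U).1 t =
      ∫ y, (U.1 (t - y) - U.1 t) ∂P - ∫ y, (U.1 (t - y) - U.1 t) ∂Q -
        a * ∫ x in t..(t + s), (U.1 x - U.1 t) := by
    rw [H.diffOp_apply, integral_sub hP (integrable_const _), integral_sub hQ (integrable_const _),
      intervalIntegral.integral_sub hUi (by simp), integral_const, integral_const,
      intervalIntegral.integral_const]
    simp only [smul_eq_mul]
    linear_combination U.1 t * H.mass_sub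
  have h1 := abs_integral_sub_le H.fst_Iio H.fst_integrable (u := U.1) (t := t) (C := a * M)
    fun x hx => hL x (by linarith)
  have h2 := abs_integral_sub_le H.snd_Iio H.snd_integrable (u := U.1) (t := t) (C := a * M)
    fun x hx => hL x (by linarith)
  have h3 : |∫ x in t..(t + s), (U.1 x - U.1 t)| ≤ a * M * |s| * |s| := by
    have := intervalIntegral.norm_integral_le_of_norm_le_const (a := t) (b := t + s)
      (f := fun x => U.1 x - U.1 t) (C := a * M * |s|) fun x hx => ?_
    · simpa using this
    · refine (hL x (hx.2.trans (max_le (by linarith) (by linarith)))).trans ?_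
      refine mul_le_mul_of_nonneg_left ?_ (by positivity)
      have := abs_sub_left_of_mem_uIcc (uIoc_subset_uIcc hx)
      simpa using this
  have h4 : |a * ∫ x in t..(t + s), (U.1 x - U.1 t)| ≤ a * (a * M * |s| * |s|) := by
    rw [abs_mul, abs_of_pos H.pos]
    exact mul_le_mul_of_nonneg_left h3 H.pos.le
  rw [hsplit, smoothConst]
  refine (abs_sub _ _).trans ?_
  have := abs_sub (∫ y, (U.1 (t - y) - U.1 t) ∂P) (∫ y, (U.1 (t - y) - U.1 t) ∂Q)
  linarith

theorem abs_diffOp_pow_le (H : IsLebesguePerturbation μ P Q a s) (k : ℕ) {u : lowerBounded}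
    {T M : ℝ} (hu : ∀ x ≤ T + k * (2 * |s|), |u.1 x| ≤ M) :
    ∀ t ≤ T, |((diffOp μ H.isLowerFinite a s ^ k) u).1 t| ≤ boundConst P Q a s ^ k * M := by
  induction k generalizing T with
  | zero => simpa using hu
  | succ k ih =>
    rw [pow_succ', pow_succ', mul_assoc]
    refine H.abs_diffOp_le (ih ?_)
    intro x hx
    refine hu x (hx.trans_eq ?_)
    push_cast
    ring

theorem abs_diffOp_mul_shiftOp_pow_le (H : IsLebesguePerturbation μ P Q a s) (k : ℕ)
    {u : lowerBounded} {T M : ℝ} (hu : ∀ x ≤ T + k * (2 * |s|), |u.1 x| ≤ M) :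
    ∀ t ≤ T, |(((diffOp μ H.isLowerFinite a s * shiftOp a s) ^ k) u).1 t| ≤
      smoothConst P Q a s ^ k * M := by
  induction k generalizing T with
  | zero => simpa using hu
  | succ k ih =>
    rw [pow_succ', pow_succ', mul_assoc (smoothConst P Q a s)]
    refine H.abs_diffOp_shiftOp_le (ih ?_)
    intro x hx
    refine hu x (hx.trans_eq ?_)
    push_cast
    ring

end IsLebesguePerturbation

/-! ### The terms of the binomial expansion, relative to the main term. -/

theorem Nat.factorial_le_factorial_sub_mul_pow {n k : ℕ} (h : k ≤ n) :
    n.factorial ≤ (n - k).factorial * n ^ k := by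
  rw [← Nat.factorial_mul_descFactorial h]
  exact Nat.mul_le_mul_left _ (Nat.descFactorial_le_pow n k)

/-- The binomial coefficient costs `j ^ k / k!` and the shorter factorial `j ^ (2 * k)`, while `2 *
k` factors `a * τ` are missing: altogether `(j ^ 3 / (a * τ) ^ 2) ^ k / k!`. -/
theorem choose_mul_pow_mul_pow_div_factorial_le {a h c τ : ℝ} (ha : 0 < a) (hh : 0 ≤ h)
    (hc : 0 ≤ c) (hτ : 0 < τ) {j k : ℕ} (hjτ : (j : ℝ) ≤ τ) (hk : 2 * k ≤ j) :
    (j.choose k : ℝ) * (h ^ k * (a ^ (j - 2 * k) * (τ + k * c) ^ (j - 2 * k) /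
      (j - 2 * k).factorial)) ≤
    a ^ j * τ ^ j / j.factorial *
      ((h * Real.exp c / a ^ 2 * (j ^ 3 / τ ^ 2)) ^ k / k.factorial) := by
  obtain ⟨n, rfl⟩ := Nat.exists_eq_add_of_le hk
  set j := 2 * k + n with hj
  have hn : j - 2 * k = n := by omega
  rw [hn]
  have h1 : (j.choose k : ℝ) ≤ j ^ k / k.factorial := Nat.choose_le_pow_div k j
  have h2 : (j.factorial : ℝ) ≤ n.factorial * j ^ (2 * k) := by
    have := Nat.factorial_le_factorial_sub_mul_pow hk
    rw [hn] at this
    exact_mod_cast this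
  have hnτ : (n : ℝ) ≤ τ := le_trans (by exact_mod_cast (by omega : n ≤ j)) hjτ
  -- As `n ≤ j ≤ τ`, the factor `(1 + k * c / τ) ^ n` is at most `exp (k * c)`, a constant to the
  -- power `k`.
  have h3 : (τ + k * c) ^ n ≤ τ ^ n * Real.exp c ^ k := by
    have h31 : τ + k * c ≤ τ * Real.exp (k * c / τ) := by
      have := Real.add_one_le_exp (k * c / τ)
      calc τ + k * c = τ * (k * c / τ + 1) := by field_simp; ring
        _ ≤ _ := mul_le_mul_of_nonneg_left this hτ.le
    calc (τ + k * c) ^ n ≤ (τ * Real.exp (k * c / τ)) ^ n :=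
          pow_le_pow_left₀ (by positivity) h31 n
      _ = τ ^ n * Real.exp (n * (k * c / τ)) := by rw [mul_pow, ← Real.exp_nat_mul]
      _ ≤ τ ^ n * Real.exp (k * c) := by
        refine mul_le_mul_of_nonneg_left (Real.exp_le_exp.2 ?_) (by positivity)
        rw [mul_div_assoc', div_le_iff₀ hτ, mul_comm]
        exact mul_le_mul_of_nonneg_left hnτ (by positivity)
      _ = _ := by rw [Real.exp_nat_mul]
  have h4 : (1 : ℝ) / n.factorial ≤ j ^ (2 * k) / j.factorial := by
    rw [div_le_div_iff₀ (by positivity) (by positivity)]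
    linarith
  calc (j.choose k : ℝ) * (h ^ k * (a ^ n * (τ + k * c) ^ n / n.factorial))
      = (j.choose k : ℝ) * (h ^ k * a ^ n * (τ + k * c) ^ n * (1 / n.factorial)) := by ring
    _ ≤ (j ^ k / k.factorial) *
        (h ^ k * a ^ n * (τ ^ n * Real.exp c ^ k) * (j ^ (2 * k) / j.factorial)) := by
      gcongr
    _ = _ := by
      rw [show a ^ j = a ^ (2 * k) * a ^ n by rw [hj, pow_add],
        show τ ^ j = τ ^ (2 * k) * τ ^ n by rw [hj, pow_add], mul_pow, div_pow, div_pow, mul_pow,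
        ← pow_mul a, ← pow_mul τ, ← pow_mul (j : ℝ) 3, show 3 * k = k + 2 * k by ring, pow_add]
      field_simp

theorem sum_Icc_pow_div_factorial_le {x : ℝ} (hx : 0 ≤ x) (j : ℕ) :
    ∑ k ∈ Finset.Icc 1 j, x ^ k / k.factorial ≤ Real.exp x - 1 := by
  have h := Real.sum_le_exp_of_nonneg hx (j + 1)
  rw [Finset.range_eq_Ico, Finset.sum_eq_sum_Ico_succ_bot (Nat.succ_pos j)] at h
  have h2 : Finset.Icc 1 j = Finset.Ico (0 + 1) (j + 1) := rfl
  rw [h2]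
  simp only [pow_zero, Nat.factorial_zero, Nat.cast_one, div_one] at h
  linarith

theorem sum_Icc_choose_mul_pow_le {a D τ : ℝ} (ha : 0 < a) (hD : 0 ≤ D) (hτ : 0 < τ) {j : ℕ}
    (hj : 2 * D / a * (j / τ) ≤ 1) :
    ∑ k ∈ Finset.Icc 1 j, (j.choose k : ℝ) * D ^ j ≤
      a ^ j * τ ^ j / j.factorial * (2 * D / a * (j / τ)) := by
  rcases Nat.eq_zero_or_pos j with rfl | hj0
  · simp
  have h1 : ∑ k ∈ Finset.Icc 1 j, (j.choose k : ℝ) ≤ 2 ^ j := by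
    have h := Nat.sum_range_choose j
    rw [Finset.range_eq_Ico, Finset.sum_eq_sum_Ico_succ_bot (Nat.succ_pos j)] at h
    have h2 : Finset.Icc 1 j = Finset.Ico (0 + 1) (j + 1) := rfl
    rw [h2]
    exact_mod_cast (Nat.le_add_left _ _).trans_eq h
  rw [← Finset.sum_mul]
  have h2 : (j.factorial : ℝ) ≤ j ^ j := by exact_mod_cast Nat.factorial_le_pow j
  calc (∑ k ∈ Finset.Icc 1 j, (j.choose k : ℝ)) * D ^ j ≤ 2 ^ j * D ^ j := by gcongr
    _ = a ^ j * τ ^ j / j ^ j * (2 * D / a * (j / τ)) ^ j := by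
      have : (0 : ℝ) < j := by exact_mod_cast hj0
      rw [← mul_pow, ← mul_pow, ← div_pow, ← mul_pow]
      congr 1
      field_simp
    -- The base is at most `1` and `j ≥ 1`, so one factor suffices; for `j = 0` the sum was empty.
    _ ≤ a ^ j * τ ^ j / j.factorial * (2 * D / a * (j / τ)) ^ 1 := by
      gcongr ?_ * ?_
      · gcongr
      · exact pow_le_pow_of_le_one (by positivity) hj hj0
    _ = _ := by rw [pow_one]

namespace IsLebesguePerturbation

variable {μ P Q : Measure ℝ} {a s : ℝ} [IsFiniteMeasure P] [IsFiniteMeasure Q] [SFinite μ]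

theorem abs_diffOp_pow_shiftOp_pow_le (H : IsLebesguePerturbation μ P Q a s) {j k : ℕ} {t : ℝ}
    (hτ : 0 < t + j * s) (hk : 2 * k ≤ j) :
    |((diffOp μ H.isLowerFinite a s ^ k * shiftOp a s ^ (j - k)) stepFn).1 t| ≤
      smoothConst P Q a s ^ k * (a ^ (j - 2 * k) * (t + j * s + k * (4 * |s|)) ^ (j - 2 * k) /
        (j - 2 * k).factorial) := by
  have hs := neg_abs_le s
  have ha := H.pos
  have hM : 0 ≤ a ^ (j - 2 * k) * (t + j * s + k * (4 * |s|)) ^ (j - 2 * k) /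
      (j - 2 * k).factorial := by positivity
  rw [show j - k = k + (j - 2 * k) by omega, pow_add, ← mul_assoc,
    ← (commute_diffOp_shiftOp H.isLowerFinite a s).mul_pow, Module.End.mul_apply]
  refine H.abs_diffOp_mul_shiftOp_pow_le k (T := t) (fun x hx => ?_) t le_rfl
  rw [shiftOp_pow_stepFn H.pos.le]
  split_ifs with hx0
  · rw [abs_of_nonneg (by positivity)]
    -- Half of the `4 * |s|` is the look-ahead of the `k` paired operators; the other half bounds
    -- `-2 * k * s`, the shift lost with the paired factors.
    have hle : x + (j - 2 * k : ℕ) * s ≤ t + j * s + k * (4 * |s|) := by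
      rw [Nat.cast_sub hk]
      push_cast
      nlinarith [mul_nonneg (Nat.cast_nonneg (α := ℝ) k) (by linarith : 0 ≤ |s| + s)]
    gcongr a ^ _ * ?_ ^ _ / _
  · simpa using hM

/-- All `j - k` factors `shiftOp` are paired, leaving `2 * k - j` unpaired `diffOp`. Only bounded
operators act on the step function. -/
theorem abs_diffOp_pow_shiftOp_pow_le_of_lt (H : IsLebesguePerturbation μ P Q a s) {j k : ℕ}
    {t D : ℝ} (hD : 1 ≤ D) (hV : boundConst P Q a s ≤ D) (hh : smoothConst P Q a s ≤ D)
    (hkj : k ≤ j) (hk : j < 2 * k) :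
    |((diffOp μ H.isLowerFinite a s ^ k * shiftOp a s ^ (j - k)) stepFn).1 t| ≤ D ^ j := by
  have h0 := H.boundConst_nonneg
  have h0' := H.smoothConst_nonneg
  have hsplit : diffOp μ H.isLowerFinite a s ^ k * shiftOp a s ^ (j - k) =
      diffOp μ H.isLowerFinite a s ^ (2 * k - j) *
        (diffOp μ H.isLowerFinite a s * shiftOp a s) ^ (j - k) := by
    rw [(commute_diffOp_shiftOp H.isLowerFinite a s).mul_pow, ← mul_assoc, ← pow_add,
      show 2 * k - j + (j - k) = k by omega]
  rw [hsplit, Module.End.mul_apply]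
  refine (H.abs_diffOp_pow_le (2 * k - j) (T := t)
    (H.abs_diffOp_mul_shiftOp_pow_le (j - k) (M := 1) fun x _ => abs_stepFn_le x) t le_rfl).trans ?_
  calc _ ≤ D ^ (2 * k - j) * (D ^ (j - k) * 1) := by gcongr
    _ = D ^ k := by rw [mul_one, ← pow_add, show 2 * k - j + (j - k) = k by omega]
    _ ≤ D ^ j := pow_le_pow_right₀ hD hkj

theorem abs_convOp_pow_stepFn_sub_le (H : IsLebesguePerturbation μ P Q a s) :
    ∃ B C : ℝ, 0 ≤ B ∧ 0 ≤ C ∧ ∀ (j : ℕ) (t : ℝ), 0 < t + j * s → (j : ℝ) ≤ t + j * s →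
      C * (j / (t + j * s)) ≤ 1 →
      |((convOp μ H.isLowerFinite ^ j) stepFn).1 t - a ^ j * (t + j * s) ^ j / j.factorial| ≤
        a ^ j * (t + j * s) ^ j / j.factorial *
          (Real.exp (B * (j ^ 3 / (t + j * s) ^ 2)) - 1 + C * (j / (t + j * s))) := by
  have ha := H.pos
  have h0 := H.smoothConst_nonneg
  -- The entry `1` permits raising `D ^ k` to `D ^ j`.
  set D := max 1 (max (boundConst P Q a s) (smoothConst P Q a s)) with hD
  have hD1 : 1 ≤ D := le_max_left _ _
  have hD0 : 0 ≤ D := zero_le_one.trans hD1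
  refine ⟨smoothConst P Q a s * Real.exp (4 * |s|) / a ^ 2, 2 * D / a, by positivity,
    by positivity, fun j t hτ hj hC => ?_⟩
  have hL : ((shiftOp a s ^ j) stepFn).1 t = a ^ j * (t + j * s) ^ j / j.factorial := by
    rw [shiftOp_pow_stepFn ha.le, if_pos hτ.le]
  rw [← hL, convOp_pow_stepFn_sub H.isLowerFinite a s, hL]
  refine (Finset.abs_sum_le_sum_abs _ _).trans ?_
  set x := smoothConst P Q a s * Real.exp (4 * |s|) / a ^ 2 * (j ^ 3 / (t + j * s) ^ 2) with hx
  have hx0 : 0 ≤ x := by positivity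
  have hG : 0 ≤ a ^ j * (t + j * s) ^ j / j.factorial := by positivity
  calc _ ≤ ∑ k ∈ Finset.Icc 1 j, (a ^ j * (t + j * s) ^ j / j.factorial *
        (x ^ k / k.factorial) + (j.choose k : ℝ) * D ^ j) := by
        refine Finset.sum_le_sum fun k hk => ?_
        rw [abs_mul, abs_of_nonneg (Nat.cast_nonneg _)]
        rcases le_or_gt (2 * k) j with hkj | hkj
        · refine le_add_of_le_of_nonneg ?_ (by positivity)
          exact (mul_le_mul_of_nonneg_left (H.abs_diffOp_pow_shiftOp_pow_le hτ hkj)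
            (Nat.cast_nonneg _)).trans
            (choose_mul_pow_mul_pow_div_factorial_le ha h0 (by positivity) hτ hj hkj)
        · refine le_add_of_nonneg_of_le (by positivity) ?_
          exact mul_le_mul_of_nonneg_left (H.abs_diffOp_pow_shiftOp_pow_le_of_lt hD1
            ((le_max_left _ _).trans (le_max_right _ _))
            ((le_max_right _ _).trans (le_max_right _ _)) (Finset.mem_Icc.1 hk).2 hkj)
            (Nat.cast_nonneg _)
    _ = a ^ j * (t + j * s) ^ j / j.factorial * ∑ k ∈ Finset.Icc 1 j, x ^ k / k.factorial +
        ∑ k ∈ Finset.Icc 1 j, (j.choose k : ℝ) * D ^ j := by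
        rw [Finset.sum_add_distrib, Finset.mul_sum]
    _ ≤ _ := by
        rw [mul_add]
        exact add_le_add (mul_le_mul_of_nonneg_left (sum_Icc_pow_div_factorial_le hx0 j) hG)
          (sum_Icc_choose_mul_pow_le ha hD0 hτ hC)

end IsLebesguePerturbation

/-! ### Decomposition of the measure of `f` through the variation of the excess. -/

theorem excessVariation_sub (f : StieltjesFunction ℝ) (a : ℝ) {x y : ℝ} (hxy : x ≤ y) :
    excessVariation f a y - excessVariation f a x =
      (eVariationOn (excess f a) (univ ∩ Icc x y)).toReal := by
  rw [← variationOnFromTo.eq_of_le _ _ hxy, sub_eq_iff_eq_add, add_comm]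
  exact (variationOnFromTo.add (excess_locallyBoundedVariationOn f a) (mem_univ _) (mem_univ _)
    (mem_univ _)).symm

theorem abs_excess_sub_le (f : StieltjesFunction ℝ) (a : ℝ) {x y : ℝ} (hxy : x ≤ y) :
    |excess f a y - excess f a x| ≤ excessVariation f a y - excessVariation f a x := by
  rw [excessVariation_sub f a hxy, ← Real.dist_eq, dist_edist, edist_comm]
  exact ENNReal.toReal_mono
    (excess_locallyBoundedVariationOn f a x y (mem_univ _) (mem_univ _))
    (eVariationOn.edist_le _ ⟨mem_univ _, le_rfl, hxy⟩ ⟨mem_univ _, hxy, le_rfl⟩)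

/-- The sum of the variation function and of `r` times the excess, for `|r| ≤ 1`. -/
noncomputable def excessVariationAdd (f : StieltjesFunction ℝ) (a r : ℝ) (hr : |r| ≤ 1) :
    StieltjesFunction ℝ where
  toFun x := excessVariation f a x + r * excess f a x
  mono' x y hxy := by
    have h := abs_excess_sub_le f a hxy
    have h1 : |r * (excess f a y - excess f a x)| ≤ 1 * |excess f a y - excess f a x| := by
      rw [abs_mul]
      exact mul_le_mul_of_nonneg_right hr (abs_nonneg _)
    have := (abs_le.1 h1).1
    simp only
    linarith
  right_continuous' x := ((excessVariation f a).right_continuous x).add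
    ((excess_continuousWithinAt f a x).const_mul r)

/-- The primitive of `a • 1_{[0, ∞)}`. -/
noncomputable def rampStieltjes (a : ℝ) (ha : 0 ≤ a) : StieltjesFunction ℝ where
  toFun x := a * max x 0
  mono' x y hxy := mul_le_mul_of_nonneg_left (max_le_max_right 0 hxy) ha
  right_continuous' x := by fun_prop

theorem rampStieltjes_measure (a : ℝ) (ha : 0 ≤ a) :
    (rampStieltjes a ha).measure = ENNReal.ofReal a • volume.restrict (Ici 0) := by
  have hl : ∀ x, Function.leftLim (rampStieltjes a ha) x = a * max x 0 := fun x =>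
    (Continuous.continuousAt (f := fun x : ℝ => a * max x 0) (by fun_prop)).continuousWithinAt.leftLim_eq
  have : IsLocallyFiniteMeasure (ENNReal.ofReal a • volume.restrict (Ici (0:ℝ))) := by
    change IsLocallyFiniteMeasure (a.toNNReal • volume.restrict (Ici (0:ℝ)))
    infer_instance
  refine Measure.ext_of_Ioc _ _ fun x y h => ?_
  rw [StieltjesFunction.measure_Ioc, Measure.smul_apply, Measure.restrict_apply measurableSet_Ioc]
  have : volume (Ioc x y ∩ Ici 0) = ENNReal.ofReal (max y 0 - max x 0) := by
    rcases le_or_gt 0 x with hx | hx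
    · rw [inter_eq_left.2 fun z (hz : z ∈ Ioc x y) => mem_Ici.2 (hx.trans hz.1.le), Real.volume_Ioc,
        max_eq_left hx, max_eq_left (hx.trans h.le)]
    · have : Ioc x y ∩ Ici 0 = Icc 0 y := by
        ext z
        simp only [mem_inter_iff, mem_Ioc, mem_Ici, mem_Icc]
        exact ⟨fun h => ⟨h.2, h.1.2⟩, fun h => ⟨⟨hx.trans_le h.1, h.2⟩, h.1⟩⟩
      rw [this, Real.volume_Icc, max_eq_right hx.le, sub_zero, sub_zero,
        ENNReal.ofReal_max, ENNReal.ofReal_zero, max_eq_left zero_le]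
  rw [this, smul_eq_mul, ← ENNReal.ofReal_mul ha]
  simp [rampStieltjes, mul_sub]

theorem measure_add_excessVariation (f : StieltjesFunction ℝ) (a : ℝ) (ha : 0 ≤ a) :
    f.measure + (excessVariation f a).measure =
      ENNReal.ofReal a • volume.restrict (Ici 0) +
        (excessVariationAdd f a 1 (by simp)).measure := by
  rw [← rampStieltjes_measure a ha, ← StieltjesFunction.measure_add,
    ← StieltjesFunction.measure_add]
  congr 1
  ext x
  simp only [excessVariationAdd, rampStieltjes, excess, StieltjesFunction.add_apply]
  ring

/-- The measures `|dε| + dε` and `|dε| - dε` are both positive and add up to `2 |dε|`. Finiteness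
and the first moment thus pass from `|dε|` to `P`. -/
theorem excessVariationAdd_measure_le (f : StieltjesFunction ℝ) (a : ℝ) :
    (excessVariationAdd f a 1 (by simp)).measure ≤
      (excessVariation f a).measure + (excessVariation f a).measure := by
  have : (excessVariationAdd f a 1 (by simp)).measure +
      (excessVariationAdd f a (-1) (by simp)).measure =
      (excessVariation f a).measure + (excessVariation f a).measure := by
    rw [← StieltjesFunction.measure_add, ← StieltjesFunction.measure_add]
    congr 1
    ext x
    simp only [excessVariationAdd, StieltjesFunction.add_apply]
    ring
  rw [← this]
  exact Measure.le_add_right le_rfl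


theorem excess_of_neg (f : StieltjesFunction ℝ) (hf : ∀ t : ℝ, t < 0 → f t = 0) (a : ℝ) {t : ℝ}
    (ht : t < 0) : excess f a t = 0 := by
  simp [excess, hf t ht, max_eq_right ht.le]

theorem eVariationOn_excess_Icc (f : StieltjesFunction ℝ) (a : ℝ) {x y : ℝ} (hxy : x ≤ y) :
    eVariationOn (excess f a) (univ ∩ Icc x y) = (excessVariation f a).measure (Ioc x y) := by
  rw [StieltjesFunction.measure_Ioc, excessVariation_sub f a hxy, ENNReal.ofReal_toReal]
  exact excess_locallyBoundedVariationOn f a x y (mem_univ _) (mem_univ _)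

theorem excessVariation_measure_Iio (f : StieltjesFunction ℝ) (hf : ∀ t : ℝ, t < 0 → f t = 0)
    (a : ℝ) : (excessVariation f a).measure (Iio 0) = 0 := by
  -- The constant need not be `0`: the normalisation is at `0`, so a jump of `ε` there appears as a
  -- negative value on the left.
  have hc : ∀ x < 0, excessVariation f a x = excessVariation f a (-1) := by
    have key : ∀ x y : ℝ, x ≤ y → y < 0 → excessVariation f a x = excessVariation f a y := by
      intro x y hxy hy
      rw [eq_comm, ← sub_eq_zero, excessVariation_sub f a hxy, eVariationOn.constant_on]
      · rfl
      · rintro _ ⟨z, hz, rfl⟩ _ ⟨z', hz', rfl⟩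
        rw [excess_of_neg f hf a (hz.2.2.trans_lt hy), excess_of_neg f hf a (hz'.2.2.trans_lt hy)]
    intro x hx
    rcases le_total x (-1) with h | h
    · exact key _ _ h (by norm_num)
    · exact (key _ _ h hx).symm
  have hl : Function.leftLim (excessVariation f a) 0 = excessVariation f a (-1) := by
    refine leftLim_eq_of_tendsto (tendsto_const_nhds.congr' ?_)
    filter_upwards [self_mem_nhdsWithin] with x hx using (hc x hx).symm
  rw [StieltjesFunction.measure_Iio (l := excessVariation f a (-1)), hl, sub_self,
    ENNReal.ofReal_zero]
  refine tendsto_const_nhds.congr' ?_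
  filter_upwards [eventually_lt_atBot 0] with x hx using (hc x hx).symm

/-- Local finiteness controls `[0, 1]`; beyond `1` the mass is dominated by the first moment. -/
theorem isFiniteMeasure_of_lintegral_lt_top (ν : Measure ℝ) [IsLocallyFiniteMeasure ν]
    (h0 : ν (Iio 0) = 0) (h : ∫⁻ y in Ici (0 : ℝ), ENNReal.ofReal y ∂ν < ⊤) :
    IsFiniteMeasure ν := by
  have h1 : ν (Ioi 1) < ⊤ := by
    refine lt_of_le_of_lt ?_ h
    calc ν (Ioi 1) = ∫⁻ y in Ioi (1 : ℝ), 1 ∂ν := by simp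
      _ ≤ ∫⁻ y in Ioi (1 : ℝ), ENNReal.ofReal y ∂ν := by
        refine setLIntegral_mono' measurableSet_Ioi fun x hx => ?_
        rw [ENNReal.one_le_ofReal]
        exact (mem_Ioi.1 hx).le
      _ ≤ _ := lintegral_mono_set fun x hx => zero_le_one.trans (mem_Ioi.1 hx).le
  have h2 : ν (Icc 0 1) < ⊤ := isCompact_Icc.measure_lt_top
  refine ⟨lt_of_le_of_lt (measure_mono (t := Iio 0 ∪ (Icc 0 1 ∪ Ioi 1)) fun x _ => ?_)
    (lt_of_le_of_lt (measure_union_le _ _) ?_)⟩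
  · rcases lt_or_ge x 0 with hx | hx
    · exact Or.inl hx
    · rcases le_or_gt x 1 with hx' | hx'
      · exact Or.inr (Or.inl ⟨hx, hx'⟩)
      · exact Or.inr (Or.inr hx')
  · rw [h0, zero_add]
    exact (measure_union_le _ _).trans_lt (ENNReal.add_lt_top.2 ⟨h2, h1⟩)

theorem integrable_id_of_lintegral_lt_top (ν : Measure ℝ)
    (h0 : ν (Iio 0) = 0) (h : ∫⁻ y in Ici (0 : ℝ), ENNReal.ofReal y ∂ν < ⊤) :
    Integrable (fun y => y) ν := by
  have hae : ∀ᵐ y ∂ν, 0 ≤ y := by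
    rw [ae_iff]
    simpa [Iio] using h0
  have hr : ν.restrict (Ici 0) = ν := Measure.restrict_eq_self_of_ae_mem hae
  rw [hr] at h
  refine ⟨measurable_id.aestronglyMeasurable, ?_⟩
  rw [hasFiniteIntegral_iff_ofReal hae]
  exact h

theorem boundedVariationOn_excess (f : StieltjesFunction ℝ) (a : ℝ)
    [IsFiniteMeasure (excessVariation f a).measure] :
    BoundedVariationOn (excess f a) univ := by
  refine ne_top_of_le_ne_top (measure_ne_top (excessVariation f a).measure univ) ?_
  rw [eVariationOn.eq_biSup_inter_Icc]
  refine iSup₂_le fun p hp => ?_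
  rw [eVariationOn_excess_Icc f a hp.2.2]
  exact measure_mono (subset_univ _)

theorem StieltjesFunction.tendsto_sub_measureReal_univ (g : StieltjesFunction ℝ)
    [IsFiniteMeasure g.measure] (h0 : g.measure (Iio 0) = 0) :
    Tendsto (fun t => g t - g (-1)) atTop (𝓝 (g.measure.real univ)) := by
  have h := (ENNReal.tendsto_toReal (measure_ne_top g.measure univ)).comp
    (tendsto_measure_Iic_atTop g.measure)
  refine h.congr' ?_
  filter_upwards [eventually_ge_atTop (-1)] with t ht
  have h1 : g.measure (Iic (-1)) = 0 :=
    measure_mono_null (fun x hx => (mem_Iic.1 hx).trans_lt (by norm_num)) h0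
  have h2 : g.measure (Iic t) = g.measure (Ioc (-1) t) := by
    refine le_antisymm ?_ (measure_mono fun x hx => hx.2)
    rw [← Iic_union_Ioc_eq_Iic ht]
    exact (measure_union_le _ _).trans (by rw [h1, zero_add])
  rw [Function.comp_apply, h2, g.measure_Ioc, ENNReal.toReal_ofReal (sub_nonneg.2 (g.mono ht))]

/-- If the total variation measure of the excess has a finite first moment, then the measure of
`f` differs from that of density `a` on `[0, ∞)` by finite measures with finite first moment. -/
theorem exists_measure_decomposition (f : StieltjesFunction ℝ) (hf : ∀ t : ℝ, t < 0 → f t = 0)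
    (a : ℝ) (ha : 0 < a)
    (hε : ∫⁻ y in Ici (0 : ℝ), ENNReal.ofReal y ∂(excessVariation f a).measure < ⊤) :
    ∃ P Q : Measure ℝ, ∃ _ : IsFiniteMeasure P, ∃ _ : IsFiniteMeasure Q,
      P (Iio 0) = 0 ∧ Q (Iio 0) = 0 ∧
      Integrable (fun y => y) P ∧ Integrable (fun y => y) Q ∧
      f.measure + Q = ENNReal.ofReal a • volume.restrict (Ici 0) + P ∧
      Tendsto (excess f a) atTop (𝓝 (P.real univ - Q.real univ)) := by
  have hQ0 := excessVariation_measure_Iio f hf a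
  have hQ := isFiniteMeasure_of_lintegral_lt_top _ hQ0 hε
  have hle := excessVariationAdd_measure_le f a
  have hP : IsFiniteMeasure (excessVariationAdd f a 1 (by simp)).measure :=
    isFiniteMeasure_of_le _ hle
  have hP0 : (excessVariationAdd f a 1 (by simp)).measure (Iio 0) = 0 :=
    le_antisymm ((hle _).trans (by simp [hQ0])) zero_le
  have hQi := integrable_id_of_lintegral_lt_top _ hQ0 hε
  refine ⟨_, _, hP, hQ, hP0, hQ0, (hQi.add_measure hQi).mono_measure hle, hQi,
    measure_add_excessVariation f a ha.le, ?_⟩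
  have h := ((StieltjesFunction.tendsto_sub_measureReal_univ _ hP0).sub
    (StieltjesFunction.tendsto_sub_measureReal_univ _ hQ0))
  refine h.congr fun t => ?_
  have := excess_of_neg f hf a (t := -1) (by norm_num)
  simp only [excessVariationAdd, this]
  ring

theorem exists_vectorMeasure_Ici_eq (f : StieltjesFunction ℝ) (hf : ∀ t : ℝ, t < 0 → f t = 0)
    (a : ℝ) {γ : ℝ} (hbv : BoundedVariationOn (excess f a) univ)
    (h : Tendsto (excess f a) atTop (𝓝 γ)) : hbv.vectorMeasure (Ici 0) = γ := by
  -- The left limit, not the value at `0`, enters the mass of `[0, ∞)`; the jump `f 0` is therefore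
  -- counted.
  have hl : Function.leftLim (excess f a) 0 = 0 := by
    refine leftLim_eq_of_tendsto (tendsto_const_nhds.congr' ?_)
    filter_upwards [self_mem_nhdsWithin] with x hx using (excess_of_neg f hf a hx).symm
  rw [hbv.vectorMeasure_Ici, hl, sub_zero, h.limUnder_eq]

/-! ### Asymptotics for `j = o(t ^ (2 / 3))`. -/

theorem abs_log_one_add_sub_le {z : ℝ} (hz : |z| ≤ 1 / 2) : |Real.log (1 + z) - z| ≤ 2 * z ^ 2 := by
  have h := Real.abs_log_sub_add_sum_range_le (x := -z) (by rw [abs_neg]; linarith) 1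
  simp only [Finset.sum_range_one, abs_neg, sub_neg_eq_add] at h
  norm_num at h
  have h1 : z ^ 2 / (1 - |z|) ≤ 2 * z ^ 2 := by
    rw [div_le_iff₀ (by linarith)]
    nlinarith [sq_nonneg z]
  rw [show Real.log (1 + z) - z = -z + Real.log (1 + z) by ring]
  exact h.trans h1

theorem tendsto_cube_div_sq {j : ℝ → ℕ}
    (hj : (fun t : ℝ => (j t : ℝ)) =o[atTop] (fun t : ℝ => t ^ (2 / 3 : ℝ))) : Tendsto (fun t : ℝ => (j t : ℝ) ^ 3 / t ^ 2) atTop (𝓝 0) := by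
  have h := hj.tendsto_div_nhds_zero.pow 3
  rw [zero_pow (by norm_num)] at h
  refine h.congr' ?_
  filter_upwards [eventually_gt_atTop 0] with t ht
  rw [div_pow, ← Real.rpow_mul_natCast ht.le]
  norm_num

theorem tendsto_div_self {j : ℝ → ℕ}
    (hj : (fun t : ℝ => (j t : ℝ)) =o[atTop] (fun t : ℝ => t ^ (2 / 3 : ℝ))) : Tendsto (fun t : ℝ => (j t : ℝ) / t) atTop (𝓝 0) := by
  have h := hj.tendsto_div_nhds_zero.mul (tendsto_rpow_neg_atTop (y := 1 / 3) (by norm_num))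
  rw [zero_mul] at h
  refine h.congr' ?_
  filter_upwards [eventually_gt_atTop 0] with t ht
  rw [div_mul_eq_mul_div, div_eq_div_iff (by positivity) (by positivity), mul_assoc]
  congr 1
  nth_rewrite 2 [← Real.rpow_one t]
  rw [← Real.rpow_add ht]
  norm_num

theorem tendsto_shift_div {j : ℝ → ℕ}
    (hj : (fun t : ℝ => (j t : ℝ)) =o[atTop] (fun t : ℝ => t ^ (2 / 3 : ℝ))) (s : ℝ) :
    Tendsto (fun t : ℝ => (t + j t * s) / t) atTop (𝓝 1) := by
  have h := ((tendsto_div_self hj).mul_const s).const_add 1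
  rw [zero_mul, add_zero] at h
  refine h.congr' ?_
  filter_upwards [eventually_gt_atTop 0] with t ht
  field_simp

theorem tendsto_div_shift {j : ℝ → ℕ}
    (hj : (fun t : ℝ => (j t : ℝ)) =o[atTop] (fun t : ℝ => t ^ (2 / 3 : ℝ))) (s : ℝ) :
    Tendsto (fun t : ℝ => (j t : ℝ) / (t + j t * s)) atTop (𝓝 0) := by
  have h := (tendsto_div_self hj).div (tendsto_shift_div hj s) one_ne_zero
  rw [zero_div] at h
  refine h.congr' ?_
  filter_upwards [eventually_gt_atTop 0] with t ht
  exact div_div_div_cancel_right₀ ht.ne' _ _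

theorem tendsto_cube_div_shift_sq {j : ℝ → ℕ}
    (hj : (fun t : ℝ => (j t : ℝ)) =o[atTop] (fun t : ℝ => t ^ (2 / 3 : ℝ))) (s : ℝ) :
    Tendsto (fun t : ℝ => (j t : ℝ) ^ 3 / (t + j t * s) ^ 2) atTop (𝓝 0) := by
  have h := (tendsto_cube_div_sq hj).div ((tendsto_shift_div hj s).pow 2) (by norm_num)
  rw [zero_div] at h
  refine h.congr' ?_
  filter_upwards [eventually_gt_atTop 0] with t ht
  rw [Pi.div_apply, div_pow]
  exact div_div_div_cancel_right₀ (by positivity) _ _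

theorem eventually_shift_pos {j : ℝ → ℕ}
    (hj : (fun t : ℝ => (j t : ℝ)) =o[atTop] (fun t : ℝ => t ^ (2 / 3 : ℝ))) (s : ℝ) : ∀ᶠ t : ℝ in atTop, 0 < t + j t * s := by
  filter_upwards [(tendsto_shift_div hj s).eventually (lt_mem_nhds one_pos),
    eventually_gt_atTop 0] with t h ht
  exact (div_pos_iff_of_pos_right ht).1 h

/-- The logarithm `j * log (1 + s * j / t)` equals `s * j ^ 2 / t + O(j ^ 3 / t ^ 2)`, and the error
vanishes exactly because of the growth condition on `j`. -/
theorem tendsto_shift_pow_mul_exp {j : ℝ → ℕ}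
    (hj : (fun t : ℝ => (j t : ℝ)) =o[atTop] (fun t : ℝ => t ^ (2 / 3 : ℝ))) (s : ℝ) :
    Tendsto (fun t : ℝ => ((t + j t * s) / t) ^ j t * Real.exp (-(s * (j t : ℝ) ^ 2 / t))) atTop
      (𝓝 1) := by
  have hz : Tendsto (fun t : ℝ => s * (j t / t)) atTop (𝓝 0) := by
    simpa using (tendsto_div_self hj).const_mul s
  have h0 : Tendsto (fun t : ℝ => (j t : ℝ) *
      (Real.log (1 + s * (j t / t)) - s * (j t / t))) atTop (𝓝 0) := by
    have h1 : Tendsto (fun t : ℝ => 2 * s ^ 2 * ((j t : ℝ) ^ 3 / t ^ 2)) atTop (𝓝 0) := by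
      simpa using (tendsto_cube_div_sq hj).const_mul (2 * s ^ 2)
    refine squeeze_zero_norm' ?_ h1
    have h2 : ∀ᶠ t : ℝ in atTop, |s * (j t / t)| ≤ 1 / 2 := by
      have := (hz.abs).eventually (ge_mem_nhds (by norm_num : |(0 : ℝ)| < 1 / 2))
      exact this
    filter_upwards [h2] with t ht
    rw [Real.norm_eq_abs, abs_mul, abs_of_nonneg (Nat.cast_nonneg _)]
    refine (mul_le_mul_of_nonneg_left (abs_log_one_add_sub_le ht) (Nat.cast_nonneg _)).trans_eq ?_
    ring
  have h := (Real.continuous_exp.tendsto 0).comp h0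
  rw [Real.exp_zero] at h
  refine h.congr' ?_
  filter_upwards [eventually_gt_atTop 0, eventually_shift_pos hj s] with t ht hτ
  have he : (t + j t * s) / t = 1 + s * (j t / t) := by
    field_simp
  have hpos : 0 < 1 + s * (j t / t) := he ▸ div_pos hτ ht
  rw [Function.comp_apply, he, mul_sub, sub_eq_add_neg, Real.exp_add, Real.exp_nat_mul,
    Real.exp_log hpos]
  congr 2
  ring

theorem tendsto_convPow_div_shift {j : ℝ → ℕ}
    (hj : (fun t : ℝ => (j t : ℝ)) =o[atTop] (fun t : ℝ => t ^ (2 / 3 : ℝ))) (f : StieltjesFunction ℝ) {P Q : Measure ℝ}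
    [IsFiniteMeasure P] [IsFiniteMeasure Q] {a s : ℝ}
    (H : IsLebesguePerturbation f.measure P Q a s) :
    Tendsto (fun t : ℝ => convPow f (j t) t /
      (a ^ j t * (t + j t * s) ^ j t / ((j t).factorial : ℝ))) atTop (𝓝 1) := by
  have ha := H.pos
  obtain ⟨B, C, hB, hC, hbound⟩ := H.abs_convOp_pow_stepFn_sub_le
  have hlim : Tendsto (fun t : ℝ => Real.exp (B * ((j t : ℝ) ^ 3 / (t + j t * s) ^ 2)) - 1 +
      C * (j t / (t + j t * s))) atTop (𝓝 0) := by
    have h1 := (Real.continuous_exp.tendsto _).comp ((tendsto_cube_div_shift_sq hj s).const_mul B)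
    have h2 := (h1.sub_const 1).add ((tendsto_div_shift hj s).const_mul C)
    simpa using h2
  rw [tendsto_iff_norm_sub_tendsto_zero]
  refine squeeze_zero' (Eventually.of_forall fun _ => norm_nonneg _) ?_ hlim
  have hC1 : ∀ᶠ t : ℝ in atTop, C * (j t / (t + j t * s)) ≤ 1 := by
    have h := (tendsto_div_shift hj s).const_mul C
    rw [mul_zero] at h
    exact h.eventually (ge_mem_nhds one_pos)
  filter_upwards [hC1, (tendsto_div_shift hj s).eventually (ge_mem_nhds one_pos),
    eventually_shift_pos hj s] with t h1 h2 hτ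
  rw [div_le_one hτ] at h2
  have h := hbound (j t) t hτ h2 h1
  rw [← convPow_eq_convOp_pow] at h
  have hG : 0 < a ^ j t * (t + j t * s) ^ j t / ((j t).factorial : ℝ) := by positivity
  rw [div_sub_one hG.ne', norm_div, Real.norm_eq_abs, Real.norm_eq_abs, abs_of_pos hG,
    div_le_iff₀ hG]
  exact h.trans_eq (mul_comm _ _)

theorem proposition3p2 (f : StieltjesFunction ℝ) (hf : ∀ t : ℝ, t < 0 → f t = 0)
    (a : ℝ) (ha : 0 < a)
    (hε : ∫⁻ y in Ici (0 : ℝ), ENNReal.ofReal y ∂(excessVariation f a).measure < ⊤) :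
    ∃ γ₀ : ℝ,
      (∃ hbv : BoundedVariationOn (excess f a) univ, hbv.vectorMeasure (Ici 0) = γ₀) ∧
      Tendsto (fun t : ℝ => f t - a * t) atTop (𝓝 γ₀) ∧
      ∀ j : ℝ → ℕ, (fun t : ℝ => (j t : ℝ)) =o[atTop] (fun t : ℝ => t ^ (2 / 3 : ℝ)) →
        Tendsto (fun t : ℝ => convPow f (j t) t /
            (a ^ j t * t ^ j t / ((j t).factorial : ℝ) *
              Real.exp (γ₀ * (j t : ℝ) ^ 2 / (a * t))))
          atTop (𝓝 1) := by
  obtain ⟨P, Q, hP, hQ, hP0, hQ0, hPi, hQi, heq, hlim⟩ := exists_measure_decomposition f hf a ha hε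
  have := isFiniteMeasure_of_lintegral_lt_top _ (excessVariation_measure_Iio f hf a) hε
  have hbv := boundedVariationOn_excess f a
  refine ⟨P.real univ - Q.real univ, ⟨hbv, exists_vectorMeasure_Ici_eq f hf a hbv hlim⟩, ?_, ?_⟩
  · refine hlim.congr' ?_
    filter_upwards [eventually_ge_atTop 0] with t ht
    rw [excess, max_eq_left ht]
  · intro j hj
    -- This shift gives the comparison density the extra mass `a * s = γ₀`, so that the difference
    -- has mass zero.
    obtain ⟨s, hs⟩ : ∃ s, P.real univ - Q.real univ = a * s :=
      ⟨(P.real univ - Q.real univ) / a, by field_simp⟩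
    have H : IsLebesguePerturbation f.measure P Q a s := ⟨ha, hP0, hQ0, hPi, hQi, heq, hs⟩
    have h := (tendsto_convPow_div_shift hj f H).mul (tendsto_shift_pow_mul_exp hj s)
    rw [mul_one] at h
    refine h.congr' ?_
    filter_upwards [eventually_gt_atTop 0, eventually_shift_pos hj s] with t ht hτ
    have he : a * s * (j t : ℝ) ^ 2 / (a * t) = s * (j t : ℝ) ^ 2 / t := by
      field_simp
    rw [hs, he, Real.exp_neg, div_pow]
    field_simp
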